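/- Let $\mathbb{C}$ be a semi-abelian category, that is, a pointed, Barr-exact, Bourn-protomodular category with binary coproducts. A *normal monomorphism* is a morphism that is the kernel of some morphism. Morphisms $f:A\to C$ and $g:B\to C$ *commute* if there is $\varphi:A\times B\to C$ with $\varphi\langle 1,0\rangle=f$ and $\varphi\langle 0,1\rangle=g$; a morphism $k:K\to X$ is *central* if $k$ and $1_X$ commute. The *(Huq) commutator* $[f,g]$ of $f:A\to C$ and $g:B\to C$ is the initial one among the normal monomorphisms $n$ with codomain $C$ such that $\mathrm{coker}(n)f$ and $\mathrm{coker}(n)g$ commute; the domain of $[1_X,1_X]$ is written $[X,X]$. The *center* of $X$ is the terminal object in the category of morphisms into $X$ that commute with $1_X$. A normal monomorphism $k:K\to X$ is *characteristic* if $nk$ is a normal monomorphism for every normal monomorphism $n:X\to Y$. For an object $B$, let $B\flat X$ be the kernel of $[1,0]:B+X\to B$; then $B\flat-$ is a monad on $\mathbb{C}$, namely the one induced by the (monadic) functor sending a split extension over $B$ to its kernel, and an *internal $B$-action* on $X$ is a morphism $\chi:B\flat X\to X$ such that $(X,\chi)$ is an algebra of this monad. Suppose that * (WNH) for each normal monomorphism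 $k:K\to X$ in $\mathbb{C}$, if the commutator $[1_K,1_K]$ exists, then $k[1_K,1_K]$ is the commutator of $k$ with itself; * the center of each object of $\mathbb{C}$ exists and is characteristic. Let $f:X\to Z$ be a morphism in $\mathbb{C}$ whose kernel is central, and let $\chi_1,\chi_2:B\flat X\to X$ be internal $B$-actions on $X$ such that $f\chi_1=f\chi_2$. Then the commutator $[1_X,1_X]:[X,X]\to X$ exists, and $\chi_1$ and $\chi_2$ restrict to the same internal $B$-action on $[X,X]$: there is an internal $B$-action $\xi:B\flat[X,X]\to[X,X]$ such that $$\chi_1\,(B\flat[1_X,1_X])=[1_X,1_X]\,\xi=\chi_2\,(B\flat[1_X,1_X]).$$ -/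

import Mathlib

open CategoryTheory CategoryTheory.Limits

universe v u

namespace SemiAb

section Basic

variable {C : Type u} [Category.{v} C] [HasZeroMorphisms C]

/-- `k` is a kernel of `f`. -/
def IsKernelOf {K X Y : C} (k : K ⟶ X) (f : X ⟶ Y) : Prop :=
  ∃ w : k ≫ f = 0, Nonempty (IsLimit (KernelFork.ofι k w))

/-- `q` is a cokernel of `f`. -/
def IsCokernelOf {X Y Q : C} (q : Y ⟶ Q) (f : X ⟶ Y) : Prop :=
  ∃ w : f ≫ q = 0, Nonempty (IsColimit (CokernelCofork.ofπ q w))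

/-- A normal monomorphism: a morphism that is the kernel of some morphism. -/
def IsNormalMono {K X : C} (k : K ⟶ X) : Prop :=
  Nonempty (NormalMono k)

/-- A normal monomorphism `k : K ⟶ X` is characteristic when its composite with every normal
monomorphism out of `X` is again normal. -/
def IsCharacteristic {K X : C} (k : K ⟶ X) : Prop :=
  IsNormalMono k ∧ ∀ ⦃Y : C⦄ (n : X ⟶ Y), IsNormalMono n → IsNormalMono (k ≫ n)

/-- The diagram `X --κ--> A --α--> B`, with `β : B ⟶ A`, is a split extension. -/
structure IsSplitExtension {X A B : C} (κ : X ⟶ A) (α : A ⟶ B) (β : B ⟶ A) : Prop where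
  section_comp : β ≫ α = 𝟙 B
  isKernel : IsKernelOf κ α

variable (C) in
/-- The split short five lemma: in every morphism `(f, g, h)` of split extensions in which `f` and
`h` are isomorphisms, so is `g`. A pointed category with finite limits is protomodular when this
holds. -/
def SplitShortFive : Prop :=
  ∀ ⦃X A B Z E D : C⦄ (κ : X ⟶ A) (α : A ⟶ B) (β : B ⟶ A) (σ : Z ⟶ E) (γ : E ⟶ D) (δ : D ⟶ E)
    (f : X ⟶ Z) (g : A ⟶ E) (h : B ⟶ D),
    IsSplitExtension κ α β → IsSplitExtension σ γ δ →
    κ ≫ g = f ≫ σ → β ≫ g = h ≫ δ → α ≫ h = g ≫ γ →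
    IsIso f → IsIso h → IsIso g

variable (C) in
/-- A semi-abelian category: pointed, Barr-exact (regular, with every internal equivalence relation
a kernel pair), protomodular, with binary coproducts. -/
class IsSemiAbelian : Prop extends HasZeroObject C, Regular C, HasBinaryCoproducts C where
  effective : ∀ ⦃R X : C⦄ (p₁ p₂ : R ⟶ X), IsEquivalenceRelation p₁ p₂ →
    ∃ (Y : C) (f : X ⟶ Y), IsKernelPair f p₁ p₂
  splitShortFive : SplitShortFive C

end Basic

section Huq

variable {C : Type u} [Category.{v} C] [HasZeroMorphisms C] [HasBinaryProducts C]

/-- The morphisms `f` and `g` commute in the sense of Huq: they have a cooperator `φ`. -/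
def HuqCommute {A B X : C} (f : A ⟶ X) (g : B ⟶ X) : Prop :=
  ∃ φ : A ⨯ B ⟶ X, prod.lift (𝟙 A) 0 ≫ φ = f ∧ prod.lift 0 (𝟙 B) ≫ φ = g

/-- `f` and `g` commute modulo `n`: they commute after composition with the cokernel of `n`. -/
def HuqCommuteMod {A B X N : C} (f : A ⟶ X) (g : B ⟶ X) (n : N ⟶ X) : Prop :=
  ∃ (Q : C) (q : X ⟶ Q), IsCokernelOf q n ∧ HuqCommute (f ≫ q) (g ≫ q)

/-- `c` is a Huq commutator of `f` and `g`: an initial object among the normal monomorphisms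
modulo which `f` and `g` commute. (The comparison morphism `t` is automatically unique, as `n` is a
monomorphism.) -/
structure IsHuqCommutator {A B X D : C} (f : A ⟶ X) (g : B ⟶ X) (c : D ⟶ X) : Prop where
  normal : IsNormalMono c
  commute : HuqCommuteMod f g c
  initial : ∀ ⦃N : C⦄ (n : N ⟶ X), IsNormalMono n → HuqCommuteMod f g n → ∃ t : D ⟶ N, t ≫ n = c

/-- `z` is a centralizer of `f`: a terminal object among the morphisms that commute with `f`. -/
structure IsCentralizer {A X Z : C} (f : A ⟶ X) (z : Z ⟶ X) : Prop where
  commute : HuqCommute z f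
  terminal : ∀ ⦃W : C⦄ (w : W ⟶ X), HuqCommute w f → ∃! t : W ⟶ Z, t ≫ z = w

/-- `z` is a center of `X`: a centralizer of the identity of `X`. -/
def IsCenter {X Z : C} (z : Z ⟶ X) : Prop :=
  IsCentralizer (𝟙 X) z

/-- A morphism is central when it commutes with the identity of its codomain. -/
def IsCentral {K X : C} (k : K ⟶ X) : Prop :=
  HuqCommute k (𝟙 X)

variable (C) in
/-- The condition (WNH): for every normal monomorphism `k : K ⟶ X`, whenever a commutator `c` of
`𝟙 K` with itself exists, its composite with `k` is a commutator of `k` with itself. -/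
def WNH : Prop :=
  ∀ ⦃K X : C⦄ (k : K ⟶ X), IsNormalMono k →
    ∀ ⦃D : C⦄ (c : D ⟶ K), IsHuqCommutator (𝟙 K) (𝟙 K) c → IsHuqCommutator k k (c ≫ k)

end Huq

section Actions

variable {C : Type u} [Category.{v} C] [HasZeroMorphisms C] [HasKernels C] [HasBinaryCoproducts C]

/-- `B ♭ X`, the kernel of `[1, 0] : B + X ⟶ B`. -/
noncomputable def flatObj (B X : C) : C :=
  kernel (coprod.desc (𝟙 B) (0 : X ⟶ B))

/-- The kernel inclusion `B ♭ X ⟶ B + X`. -/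
noncomputable def flatι (B X : C) : flatObj B X ⟶ B ⨿ X :=
  kernel.ι (coprod.desc (𝟙 B) (0 : X ⟶ B))

instance (B X : C) : Mono (flatι B X) :=
  inferInstanceAs (Mono (kernel.ι (coprod.desc (𝟙 B) (0 : X ⟶ B))))

theorem flatι_desc (B X : C) : flatι B X ≫ coprod.desc (𝟙 B) (0 : X ⟶ B) = 0 :=
  kernel.condition _

/-- The morphism into `B ♭ X` induced by a morphism into `B + X` killed by `[1, 0]`. -/
noncomputable def flatLift {B X W : C} (w : W ⟶ B ⨿ X)
    (h : w ≫ coprod.desc (𝟙 B) (0 : X ⟶ B) = 0) : W ⟶ flatObj B X :=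
  kernel.lift _ w h

theorem flatLift_ι {B X W : C} (w : W ⟶ B ⨿ X)
    (h : w ≫ coprod.desc (𝟙 B) (0 : X ⟶ B) = 0) : flatLift w h ≫ flatι B X = w :=
  kernel.lift_ι _ _ _

/-- The action of `B ♭ -` on morphisms: the restriction of `1 + f`. -/
noncomputable def flatMap (B : C) {X Y : C} (f : X ⟶ Y) : flatObj B X ⟶ flatObj B Y :=
  flatLift (flatι B X ≫ coprod.map (𝟙 B) f) (by simp [flatι_desc])

@[simp]
theorem flatMap_ι (B : C) {X Y : C} (f : X ⟶ Y) :
    flatMap B f ≫ flatι B Y = flatι B X ≫ coprod.map (𝟙 B) f :=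
  flatLift_ι _ _

@[simp]
theorem flatMap_ι_assoc (B : C) {X Y W : C} (f : X ⟶ Y) (h : B ⨿ Y ⟶ W) :
    flatMap B f ≫ flatι B Y ≫ h = flatι B X ≫ coprod.map (𝟙 B) f ≫ h := by
  rw [← Category.assoc, flatMap_ι, Category.assoc]

/-- The unit `X ⟶ B ♭ X`, the corestriction of the coproduct inclusion `X ⟶ B + X`. -/
noncomputable def flatUnit (B X : C) : X ⟶ flatObj B X :=
  flatLift coprod.inr (coprod.inr_desc _ _)

@[simp]
theorem flatUnit_ι (B X : C) : flatUnit B X ≫ flatι B X = coprod.inr :=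
  flatLift_ι _ _

@[simp]
theorem flatUnit_ι_assoc (B X : C) {W : C} (h : B ⨿ X ⟶ W) :
    flatUnit B X ≫ flatι B X ≫ h = coprod.inr ≫ h := by
  rw [← Category.assoc, flatUnit_ι]

/-- The multiplication `B ♭ (B ♭ X) ⟶ B ♭ X`, the restriction of
`[ι₁, k] : B + (B ♭ X) ⟶ B + X`, where `k` is the inclusion of `B ♭ X`. -/
noncomputable def flatMul (B X : C) : flatObj B (flatObj B X) ⟶ flatObj B X :=
  flatLift (flatι B (flatObj B X) ≫ coprod.desc coprod.inl (flatι B X)) (by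
    rw [Category.assoc, coprod.desc_comp, coprod.inl_desc, flatι_desc, flatι_desc])

@[simp]
theorem flatMul_ι (B X : C) : flatMul B X ≫ flatι B X =
    flatι B (flatObj B X) ≫ coprod.desc coprod.inl (flatι B X) :=
  flatLift_ι _ _

@[simp]
theorem flatMul_ι_assoc (B X : C) {W : C} (h : B ⨿ X ⟶ W) : flatMul B X ≫ flatι B X ≫ h =
    flatι B (flatObj B X) ≫ coprod.desc coprod.inl (flatι B X) ≫ h := by
  rw [← Category.assoc, flatMul_ι, Category.assoc]

/-- The monad `B ♭ -`. It is the monad of the adjunction between the kernel functor on split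
extensions over `B` and its left adjoint, which takes `X` to `B + X` with `[1, 0]` and `ι₁`. -/
noncomputable def flatMonad (B : C) : Monad C where
  obj X := flatObj B X
  map f := flatMap B f
  map_id X := by
    rw [← cancel_mono (flatι B X)]
    simp
  map_comp f g := by
    rw [← cancel_mono (flatι B _)]
    simp
  η :=
    { app := fun X => flatUnit B X
      naturality := fun X Y f => by
        rw [← cancel_mono (flatι B _)]
        simp }
  μ :=
    { app := fun X => flatMul B X
      naturality := fun X Y f => by
        rw [← cancel_mono (flatι B _)]
        simp }
  assoc X := by
    rw [← cancel_mono (flatι B _)]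
    simp [coprod.inl_desc]
  left_unit X := by
    rw [← cancel_mono (flatι B _)]
    simp [coprod.inr_desc]
  right_unit X := by
    rw [← cancel_mono (flatι B _)]
    simp

/-- `χ : B ♭ X ⟶ X` is an internal `B`-action on `X`: the pair `(X, χ)` is an algebra of the
monad `B ♭ -`. -/
def IsInternalAction {B X : C} (χ : (flatMonad B).obj X ⟶ X) : Prop :=
  (flatMonad B).η.app X ≫ χ = 𝟙 X ∧
    (flatMonad B).μ.app X ≫ χ = (flatMonad B).map χ ≫ χ

/-- The internal `B`-action `χ` on `X` restricts to the internal `B`-action `ξ` on `S` along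
`m : S ⟶ X`: the morphism `m` is a morphism of internal `B`-actions `(S, ξ) ⟶ (X, χ)`. -/
def RestrictsTo {B X S : C} (χ : (flatMonad B).obj X ⟶ X) (m : S ⟶ X)
    (ξ : (flatMonad B).obj S ⟶ S) : Prop :=
  (flatMonad B).map m ≫ χ = ξ ≫ m

end Actions

end SemiAb

/-!
An action of `B` on `X` is the conjugation action of a semidirect product, so a subobject of `X`
which is normal in the semidirect product is stable under the action
(`IsInternalAction.exists_isSplitExtension`, `exists_restriction_of_normal`). In groups, if two
actions agree modulo a central subgroup, then `b ⋆ x = z (b · x)` with `z` central, and central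
factors disappear from commutators. The argument here is an element-free form of this.

Let `z : Z ⟶ X` be the center. It is characteristic, hence normal in the semidirect product `A` for
`χ₁`, say the kernel of `s : A ⟶ Y`; then `z` is also the kernel of `g : X ⟶ A ⟶ Y`. The kernel of
`f` factors through `z`, so by protomodularity the kernel pair of `f` is contained in that of `g`
(`comp_eq_of_kernel_comp_eq_zero`), and `χ₁` and `χ₂` agree after composition with `g`. Since `z` is
central, the kernel pair of `g` is `Z ⨯ X`, with the cooperator `φ` and the second projection as its
two projections to `X` (`IsKernelOf.isKernelPair_of_central`). The two actions together define an
action `ρ` of `B` on `Z ⨯ X` for which `φ` is equivariant to `χ₁` and the second projection to `χ₂`.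
As `Z` is commutative, the commutator of `Z ⨯ X` is `0 × [X, X]` (`IsHuqCommutator.prod`), which by
(WNH) is normal in the semidirect product for `ρ`, and so inherits an action `ξ` from `ρ`. Both `φ`
and the second projection restrict to `[1_X, 1_X]` on `0 × [X, X]`, so `ξ` is the restriction of
`χ₁` and of `χ₂`.

Apart from this, the file develops the needed theory of semi-abelian categories from the split
short five lemma: kernel and section of a split extension are jointly extremally epic
(`isIso_of_kernel_section_factor`), relations are difunctional, hence reflexive relations are
equivalence relations, hence reflexive pairs have coequalizers. This provides cokernels, commutators
(`exists_isHuqCommutator_id`) and semidirect products.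
-/

namespace SemiAb

attribute [local simp] prod.lift_fst prod.lift_fst_assoc prod.lift_snd prod.lift_snd_assoc
  coprod.inl_desc coprod.inl_desc_assoc coprod.inr_desc coprod.inr_desc_assoc
  pullback.lift_fst pullback.lift_fst_assoc pullback.lift_snd pullback.lift_snd_assoc

/-! ### Kernels, cokernels and regular epimorphisms -/

/-- The universal property of a regular epimorphism, in terms of generalized elements of its
kernel pair. -/
theorem exists_desc_of_isRegularEpi {C : Type u} [Category.{v} C] {X Y T : C} (q : X ⟶ Y)
    [IsRegularEpi q] (t : X ⟶ T)
    (h : ∀ ⦃W : C⦄ (a b : W ⟶ X), a ≫ q = b ≫ q → a ≫ t = b ≫ t) : ∃ l : Y ⟶ T, q ≫ l = t :=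
  ⟨IsRegularEpi.desc q t (h _ _ (IsRegularEpi.w q)), IsRegularEpi.fac q t _⟩

section Kernels

variable {C : Type u} [Category.{v} C] [HasZeroMorphisms C]

theorem isKernelOf_iff {K X Y : C} {k : K ⟶ X} {f : X ⟶ Y} :
    IsKernelOf k f ↔
      k ≫ f = 0 ∧ Mono k ∧ ∀ ⦃T : C⦄ (t : T ⟶ X), t ≫ f = 0 → ∃ l : T ⟶ K, l ≫ k = t := by
  constructor
  · rintro ⟨w, ⟨h⟩⟩
    refine ⟨w, mono_of_isLimit_fork h, fun T t ht => ?_⟩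
    obtain ⟨l, hl⟩ := KernelFork.IsLimit.lift' h t ht
    exact ⟨l, hl⟩
  · rintro ⟨w, hm, h⟩
    choose l hl using h
    exact ⟨w, ⟨KernelFork.IsLimit.ofι k w (fun t ht => l t ht) (fun t ht => hl t ht)
      fun t ht m hm' => by rw [← cancel_mono k, hm', hl]⟩⟩

theorem isCokernelOf_iff {X Y Q : C} {q : Y ⟶ Q} {f : X ⟶ Y} :
    IsCokernelOf q f ↔
      f ≫ q = 0 ∧ Epi q ∧ ∀ ⦃T : C⦄ (t : Y ⟶ T), f ≫ t = 0 → ∃ l : Q ⟶ T, q ≫ l = t := by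
  constructor
  · rintro ⟨w, ⟨h⟩⟩
    refine ⟨w, epi_of_isColimit_cofork h, fun T t ht => ?_⟩
    obtain ⟨l, hl⟩ := CokernelCofork.IsColimit.desc' h t ht
    exact ⟨l, hl⟩
  · rintro ⟨w, hm, h⟩
    choose l hl using h
    exact ⟨w, ⟨CokernelCofork.IsColimit.ofπ q w (fun t ht => l t ht) (fun t ht => hl t ht)
      fun t ht m hm' => by rw [← cancel_epi q, hm', hl]⟩⟩

theorem isNormalMono_iff {K X : C} {k : K ⟶ X} :
    IsNormalMono k ↔ ∃ (Y : C) (f : X ⟶ Y), IsKernelOf k f :=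
  ⟨fun ⟨h⟩ => ⟨h.Z, h.g, h.w, ⟨h.isLimit⟩⟩, fun ⟨Y, f, w, ⟨h⟩⟩ => ⟨⟨Y, f, w, h⟩⟩⟩

theorem isKernelOf_kernel {X Y : C} (f : X ⟶ Y) [HasKernel f] : IsKernelOf (kernel.ι f) f :=
  ⟨kernel.condition f, ⟨kernelIsKernel f⟩⟩

theorem IsKernelOf.isNormalMono {K X Y : C} {k : K ⟶ X} {f : X ⟶ Y} (h : IsKernelOf k f) :
    IsNormalMono k :=
  isNormalMono_iff.2 ⟨Y, f, h⟩

theorem IsKernelOf.of_comp_mono {K X Y Z : C} {k : K ⟶ X} {f : X ⟶ Y} {m : Y ⟶ Z} [Mono m]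
    (h : IsKernelOf k (f ≫ m)) : IsKernelOf k f := by
  obtain ⟨w, hm, h⟩ := isKernelOf_iff.1 h
  refine isKernelOf_iff.2 ⟨?_, hm, fun T t ht => h t (by rw [reassoc_of% ht, zero_comp])⟩
  rw [← cancel_mono m, Category.assoc, w, zero_comp]

theorem IsKernelOf.of_isCokernelOf {K X Q : C} {k : K ⟶ X} {q : X ⟶ Q} (hk : IsNormalMono k)
    (hq : IsCokernelOf q k) : IsKernelOf k q := by
  obtain ⟨Y, f, hf⟩ := isNormalMono_iff.1 hk
  obtain ⟨w, hm, h⟩ := isKernelOf_iff.1 hf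
  obtain ⟨w', -, h'⟩ := isCokernelOf_iff.1 hq
  obtain ⟨l, rfl⟩ := h' f w
  exact isKernelOf_iff.2 ⟨w', hm, fun T t ht => h t (by rw [reassoc_of% ht, zero_comp])⟩

/-- The second projection of the kernel pair of `f`, with the diagonal as section, has the kernel
of `f` as its kernel. -/
theorem isSplitExtension_kernelPair {X Y K R : C} {f : X ⟶ Y} {k : K ⟶ X} (hk : IsKernelOf k f)
    {p₁ p₂ : R ⟶ X} (hp : IsKernelPair f p₁ p₂) :
    IsSplitExtension (hp.lift k 0 (by simpa using (isKernelOf_iff.1 hk).1)) p₂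
      (hp.lift (𝟙 X) (𝟙 X) rfl) := by
  obtain ⟨w, hm, hl⟩ := isKernelOf_iff.1 hk
  refine ⟨hp.lift_snd _ _ _, isKernelOf_iff.2 ⟨hp.lift_snd _ _ _, ?_, fun T t ht => ?_⟩⟩
  · have : Mono (hp.lift k 0 (by simpa using w) ≫ p₁) := by rwa [hp.lift_fst]
    exact mono_of_mono _ p₁
  · obtain ⟨l, hl⟩ := hl (t ≫ p₁) (by rw [Category.assoc, hp.w, reassoc_of% ht, zero_comp])
    refine ⟨l, hp.hom_ext ?_ ?_⟩
    · rw [Category.assoc, hp.lift_fst, hl]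
    · rw [Category.assoc, hp.lift_snd, comp_zero, ht]

end Kernels

/-! ### Consequences of the split short five lemma -/

section Protomodular

variable {C : Type u} [Category.{v} C] [HasZeroMorphisms C] [IsSemiAbelian C]

/-- Kernel and section of a split extension are jointly extremally epic. -/
theorem isIso_of_kernel_section_factor {E B K M : C} {κ : K ⟶ E} {α : E ⟶ B} {β : B ⟶ E}
    (h : IsSplitExtension κ α β) (m : M ⟶ E) [Mono m] (k : K ⟶ M) (s : B ⟶ M)
    (hk : k ≫ m = κ) (hs : s ≫ m = β) : IsIso m := by
  obtain ⟨w, hm, hl⟩ := isKernelOf_iff.1 h.isKernel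
  have h' : IsSplitExtension k (m ≫ α) s := by
    refine ⟨by rw [reassoc_of% hs, h.section_comp], isKernelOf_iff.2 ⟨?_, ?_, fun T t ht => ?_⟩⟩
    · rw [reassoc_of% hk, w]
    · have : Mono (k ≫ m) := by rwa [hk]
      exact mono_of_mono k m
    · obtain ⟨l, hl⟩ := hl (t ≫ m) (by simpa using ht)
      exact ⟨l, by rw [← cancel_mono m, Category.assoc, hk, hl]⟩
  exact IsSemiAbelian.splitShortFive k (m ≫ α) s κ α β (𝟙 _) m (𝟙 _) h' h (by simp [hk])
    (by simp [hs]) (by simp) inferInstance inferInstance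

theorem IsSplitExtension.hom_ext {E B K T : C} {κ : K ⟶ E} {α : E ⟶ B} {β : B ⟶ E}
    (h : IsSplitExtension κ α β) {u v : E ⟶ T} (hκ : κ ≫ u = κ ≫ v) (hβ : β ≫ u = β ≫ v) :
    u = v := by
  have := isIso_of_kernel_section_factor h (equalizer.ι u v) (equalizer.lift κ hκ)
    (equalizer.lift β hβ) (by simp) (by simp)
  rw [← cancel_epi (equalizer.ι u v), equalizer.condition]

theorem isSplitExtension_prod (X Y : C) :
    IsSplitExtension (prod.lift (𝟙 X) 0) (prod.snd : X ⨯ Y ⟶ Y) (prod.lift 0 (𝟙 Y)) := by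
  refine ⟨by simp, isKernelOf_iff.2 ⟨by simp, ?_, fun T t ht => ⟨t ≫ prod.fst, ?_⟩⟩⟩
  · have : Mono (prod.lift (𝟙 X) (0 : X ⟶ Y) ≫ prod.fst) := by
      rw [prod.lift_fst]; infer_instance
    exact mono_of_mono _ prod.fst
  · ext <;> simp [ht]

theorem isIso_of_inclusions_factor {X Y M : C} (m : M ⟶ X ⨯ Y) [Mono m] (a : X ⟶ M) (b : Y ⟶ M)
    (ha : a ≫ m = prod.lift (𝟙 X) 0) (hb : b ≫ m = prod.lift 0 (𝟙 Y)) : IsIso m :=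
  isIso_of_kernel_section_factor (isSplitExtension_prod X Y) m a b ha hb

theorem prod_hom_ext_of_inclusions {X Y T : C} {u v : X ⨯ Y ⟶ T}
    (h₁ : prod.lift (𝟙 X) 0 ≫ u = prod.lift (𝟙 X) 0 ≫ v)
    (h₂ : prod.lift 0 (𝟙 Y) ≫ u = prod.lift 0 (𝟙 Y) ≫ v) : u = v :=
  (isSplitExtension_prod X Y).hom_ext h₁ h₂

/-- If `g` kills the kernel of `f`, then the kernel pair of `f` is contained in that of `g`. -/
theorem comp_eq_of_kernel_comp_eq_zero {X Y Z K T : C} {f : X ⟶ Y} {k : K ⟶ X}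
    (hk : IsKernelOf k f) {g : X ⟶ Z} (hg : k ≫ g = 0) {a b : T ⟶ X} (h : a ≫ f = b ≫ f) :
    a ≫ g = b ≫ g := by
  have hp := IsKernelPair.of_hasPullback f
  have key : pullback.fst f f ≫ g = pullback.snd f f ≫ g := by
    refine (isSplitExtension_kernelPair hk hp).hom_ext ?_ ?_
    · rw [← Category.assoc, ← Category.assoc, hp.lift_fst, hp.lift_snd, hg, zero_comp]
    · rw [← Category.assoc, ← Category.assoc, hp.lift_fst, hp.lift_snd]
  rw [← hp.lift_fst a b h, Category.assoc, key, ← Category.assoc, hp.lift_snd]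

theorem exists_regularEpi_mono_fac {X Y : C} (f : X ⟶ Y) :
    ∃ (I : C) (e : X ⟶ I) (m : I ⟶ Y), IsRegularEpi e ∧ Mono m ∧ e ≫ m = f :=
  let F := Regular.strongEpiMonoFactorisation f
  ⟨F.I, F.e, F.m, inferInstanceAs (IsRegularEpi (Regular.strongEpiMonoFactorisation f).e),
    F.m_mono, F.fac⟩

theorem IsKernelOf.isCokernelOf {X Y K : C} {q : X ⟶ Y} [IsRegularEpi q] {k : K ⟶ X}
    (hk : IsKernelOf k q) : IsCokernelOf q k :=
  isCokernelOf_iff.2 ⟨(isKernelOf_iff.1 hk).1, inferInstance, fun _ t ht =>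
    exists_desc_of_isRegularEpi q t fun _ _ _ h => comp_eq_of_kernel_comp_eq_zero hk ht h⟩

/-- An extremal epimorphism is regular; that it is an epimorphism need not be assumed. -/
theorem isRegularEpi_of_mono_factor {X Y : C} (f : X ⟶ Y)
    (h : ∀ ⦃I : C⦄ (e : X ⟶ I) (m : I ⟶ Y), Mono m → e ≫ m = f → IsIso m) : IsRegularEpi f := by
  have : ExtremalEpi f := by
    obtain ⟨I, e, m, he, hm, rfl⟩ := exists_regularEpi_mono_fac f
    have := h e m hm rfl
    have : Epi (e ≫ m) := epi_comp _ _
    exact ⟨fun e' m' h' hm' => h e' m' hm' h'⟩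
  infer_instance

end Protomodular

/-! ### Relations and quotients -/

section Exact

variable {C : Type u} [Category.{v} C] [HasZeroMorphisms C] [IsSemiAbelian C]

/-- Every relation is difunctional: in terms of generalized elements, if `x R y`, `x' R y` and
`x' R y'`, then `x R y'`. -/
theorem difunctional {R X T : C} (p₁ p₂ : R ⟶ X) (hR : JointlyMono₂ p₁ p₂) (r₁ r₂ r₃ : T ⟶ R)
    (h₁₂ : r₁ ≫ p₂ = r₂ ≫ p₂) (h₂₃ : r₂ ≫ p₁ = r₃ ≫ p₁) :
    ∃ r : T ⟶ R, r ≫ p₁ = r₁ ≫ p₁ ∧ r ≫ p₂ = r₃ ≫ p₂ := by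
  have : Mono (prod.lift p₁ p₂) := ⟨fun a b h => hR.right_cancellation a b
    (by simpa using h =≫ prod.fst) (by simpa using h =≫ prod.snd)⟩
  let u := pullback.snd p₂ p₂
  let v := pullback.fst p₁ p₁
  let w : pullback u v ⟶ X ⨯ X := prod.lift (pullback.fst u v ≫ pullback.fst p₂ p₂ ≫ p₁)
    (pullback.snd u v ≫ pullback.snd p₁ p₁ ≫ p₂)
  let s : pullback p₁ p₁ ⟶ pullback u v :=
    pullback.lift (pullback.lift v v rfl) (𝟙 _) (by simp [u])
  have hs : s ≫ pullback.snd u v = 𝟙 _ := pullback.lift_snd _ _ _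
  have hse : IsSplitExtension (kernel.ι (pullback.snd u v)) (pullback.snd u v) s :=
    ⟨hs, isKernelOf_kernel _⟩
  let k := kernel.ι (pullback.snd u v)
  have hk : k ≫ pullback.snd u v = 0 := kernel.condition _
  have hk' : k ≫ pullback.fst u v ≫ pullback.fst p₂ p₂ ≫ p₂ = 0 := by
    rw [pullback.condition (f := p₂) (g := p₂), pullback.condition_assoc (f := u) (g := v),
      reassoc_of% hk, zero_comp]
  -- `pullback u v` consists of the `(x, y, x', y')` with `x R y`, `x' R y`, `x' R y'`, and the
  -- pullback below of those which in addition satisfy `x R y'`. The latter contain the section,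
  -- where `x = x'`, and the kernel, where `x' = y = y' = 0`.
  have : IsIso (pullback.fst w (prod.lift p₁ p₂)) := by
    refine isIso_of_kernel_section_factor hse _
      (pullback.lift k (k ≫ pullback.fst u v ≫ pullback.fst p₂ p₂) ?_)
      (pullback.lift s (pullback.snd p₁ p₁) ?_) (pullback.lift_fst _ _ _)
      (pullback.lift_fst _ _ _)
    · ext
      · simp [w]
      · simp [w, hk', reassoc_of% hk]
    · ext
      · simp [w, s, v, pullback.condition]
      · simp [w, reassoc_of% hs]
  let t : T ⟶ pullback u v := pullback.lift (pullback.lift r₁ r₂ h₁₂) (pullback.lift r₂ r₃ h₂₃)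
    (by simp [u, v])
  have key : t ≫ w = t ≫ inv (pullback.fst w (prod.lift p₁ p₂)) ≫
      pullback.snd w (prod.lift p₁ p₂) ≫ prod.lift p₁ p₂ := by
    rw [← pullback.condition, IsIso.inv_hom_id_assoc]
  refine ⟨t ≫ inv (pullback.fst w (prod.lift p₁ p₂)) ≫ pullback.snd w (prod.lift p₁ p₂), ?_, ?_⟩
  · simpa [w, t] using (key =≫ prod.fst).symm
  · simpa [w, t] using (key =≫ prod.snd).symm

/-- The Mal'tsev property. -/
theorem isEquivalenceRelation_of_reflexive {R X : C} (p₁ p₂ : R ⟶ X) (hR : JointlyMono₂ p₁ p₂)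
    (e : X ⟶ R) (h₁ : e ≫ p₁ = 𝟙 X) (h₂ : e ≫ p₂ = 𝟙 X) : IsEquivalenceRelation p₁ p₂ := by
  obtain ⟨s, hs₁, hs₂⟩ := difunctional p₁ p₂ hR (p₂ ≫ e) (𝟙 R) (p₁ ≫ e) (by simp [h₂])
    (by simp [h₁])
  obtain ⟨t, ht₁, ht₂⟩ := difunctional p₁ p₂ hR (pullback.fst p₂ p₁)
    (pullback.fst p₂ p₁ ≫ p₂ ≫ e) (pullback.snd p₂ p₁) (by simp [h₂])
    (by simp [h₁, pullback.condition])
  exact ⟨⟨{ hR with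
    r := e
    reflexivity₁ := h₁
    reflexivity₂ := h₂
    s := s
    symmetry₁ := by rw [hs₁, Category.assoc, h₁, Category.comp_id]
    symmetry₂ := by rw [hs₂, Category.assoc, h₂, Category.comp_id]
    c := pullback.cone p₂ p₁
    isLimit := pullback.isLimit p₂ p₁
    t := t
    transitivity₁ := ht₁
    transitivity₂ := ht₂ }⟩⟩

/-- A reflexive pair `d₀, d₁` has a coequalizer `q`, and its image in `X ⨯ X` is the whole kernel
pair of `q`. -/
theorem exists_quotient_of_reflexive_pair {T X : C} (d₀ d₁ : T ⟶ X) (s : X ⟶ T)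
    (h₀ : s ≫ d₀ = 𝟙 X) (h₁ : s ≫ d₁ = 𝟙 X) :
    ∃ (R Q : C) (e : T ⟶ R) (p₁ p₂ : R ⟶ X) (q : X ⟶ Q), IsRegularEpi e ∧ IsRegularEpi q ∧
      e ≫ p₁ = d₀ ∧ e ≫ p₂ = d₁ ∧ IsKernelPair q p₁ p₂ := by
  obtain ⟨R, e, m, he, hm, hem⟩ := exists_regularEpi_mono_fac (prod.lift d₀ d₁)
  have e₁ : e ≫ m ≫ prod.fst = d₀ := by rw [reassoc_of% hem, prod.lift_fst]
  have e₂ : e ≫ m ≫ prod.snd = d₁ := by rw [reassoc_of% hem, prod.lift_snd]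
  have hR : JointlyMono₂ (m ≫ prod.fst) (m ≫ prod.snd) := ⟨fun Y f g h h' => by
    rw [← cancel_mono m]
    ext <;> simpa⟩
  obtain ⟨Y, f, hf⟩ := IsSemiAbelian.effective _ _ (isEquivalenceRelation_of_reflexive _ _ hR
    (s ≫ e) (by rw [Category.assoc, e₁, h₀]) (by rw [Category.assoc, e₂, h₁]))
  obtain ⟨Q, q, n, hq, hn, rfl⟩ := exists_regularEpi_mono_fac f
  exact ⟨R, Q, e, _, _, q, he, hq, e₁, e₂, hf.cancel_right_of_mono⟩

theorem exists_isCokernelOf {A X : C} (f : A ⟶ X) : ∃ (Q : C) (q : X ⟶ Q), IsCokernelOf q f := by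
  -- A cokernel of `f` is a coequalizer of `[f, 1], [0, 1] : A + X ⇉ X`, a reflexive pair.
  obtain ⟨R, Q, e, p₁, p₂, q, he, hq, h₁, h₂, hp⟩ := exists_quotient_of_reflexive_pair
    (coprod.desc f (𝟙 X)) (coprod.desc 0 (𝟙 X)) coprod.inr (by simp) (by simp)
  refine ⟨Q, q, isCokernelOf_iff.2 ⟨?_, inferInstance, fun T t ht => ?_⟩⟩
  · have h := coprod.inl ≫= (e ≫= hp.w)
    rw [reassoc_of% h₁, reassoc_of% h₂] at h
    simpa using h
  · have h : p₁ ≫ t = p₂ ≫ t := by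
      rw [← cancel_epi e, reassoc_of% h₁, reassoc_of% h₂]
      ext <;> simp [ht]
    refine exists_desc_of_isRegularEpi q t fun W a b hab => ?_
    rw [← hp.lift_fst a b hab, Category.assoc, h, ← Category.assoc, hp.lift_snd]

end Exact

/-! ### Commuting morphisms and commutators -/

section Commutators

variable {C : Type u} [Category.{v} C] [HasZeroMorphisms C] [IsSemiAbelian C]

theorem HuqCommute.comp {A B X Y : C} {f : A ⟶ X} {g : B ⟶ X} (h : HuqCommute f g) (t : X ⟶ Y) :
    HuqCommute (f ≫ t) (g ≫ t) := by
  obtain ⟨φ, rfl, rfl⟩ := h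
  exact ⟨φ ≫ t, by simp, by simp⟩

theorem HuqCommute.precomp {A B A' B' X : C} {f : A ⟶ X} {g : B ⟶ X} (h : HuqCommute f g)
    (a : A' ⟶ A) (b : B' ⟶ B) : HuqCommute (a ≫ f) (b ≫ g) := by
  obtain ⟨φ, rfl, rfl⟩ := h
  refine ⟨prod.map a b ≫ φ, ?_, ?_⟩
  · simp only [← Category.assoc]; congr 1; ext <;> simp
  · simp only [← Category.assoc]; congr 1; ext <;> simp

/-- Monomorphisms reflect commuting pairs: the pullback of `m` along a cooperator contains both
inclusions into the product, hence is an isomorphism. -/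
theorem HuqCommute.of_comp_mono {A B X Y : C} {f : A ⟶ X} {g : B ⟶ X} {m : X ⟶ Y} [Mono m]
    (h : HuqCommute (f ≫ m) (g ≫ m)) : HuqCommute f g := by
  obtain ⟨φ, h₁, h₂⟩ := h
  have := isIso_of_inclusions_factor (pullback.fst φ m) (pullback.lift _ f h₁)
    (pullback.lift _ g h₂) (by simp) (by simp)
  refine ⟨inv (pullback.fst φ m) ≫ pullback.snd φ m, ?_, ?_⟩
  · rw [← cancel_mono m]; simp [← pullback.condition, h₁]
  · rw [← cancel_mono m]; simp [← pullback.condition, h₂]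

/-- Commuting modulo a kernel of `h` can be tested after composition with `h`, although `h` need
not be a cokernel. -/
theorem huqCommuteMod_iff {A B X Y N : C} {f : A ⟶ X} {g : B ⟶ X} {n : N ⟶ X} {h : X ⟶ Y}
    (hn : IsKernelOf n h) : HuqCommuteMod f g n ↔ HuqCommute (f ≫ h) (g ≫ h) := by
  constructor
  · rintro ⟨Q, q, hq, hc⟩
    obtain ⟨l, rfl⟩ := (isCokernelOf_iff.1 hq).2.2 h (isKernelOf_iff.1 hn).1
    simpa using hc.comp l
  · intro hc
    obtain ⟨I, e, m, he, hm, rfl⟩ := exists_regularEpi_mono_fac h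
    refine ⟨I, e, hn.of_comp_mono.isCokernelOf, HuqCommute.of_comp_mono (m := m) ?_⟩
    simpa using hc

theorem isRegularEpi_coprod_to_prod (X Y : C) :
    IsRegularEpi (coprod.desc (prod.lift (𝟙 X) 0) (prod.lift 0 (𝟙 Y)) : X ⨿ Y ⟶ X ⨯ Y) :=
  isRegularEpi_of_mono_factor _ fun I e m hm h =>
    isIso_of_inclusions_factor m (coprod.inl ≫ e) (coprod.inr ≫ e) (by simp [h]) (by simp [h])

/-- The commutator of `𝟙 X` with itself is the kernel of `q : X ⟶ Q`, where `q` is the pushout of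
`X ⨿ X ⟶ X ⨯ X` along the codiagonal. As `X ⨿ X ⟶ X ⨯ X` is the cokernel of its kernel, `q` is
obtained as a cokernel. -/
theorem exists_isHuqCommutator_id (X : C) :
    ∃ (D : C) (c : D ⟶ X), IsHuqCommutator (𝟙 X) (𝟙 X) c := by
  let r : X ⨿ X ⟶ X ⨯ X := coprod.desc (prod.lift (𝟙 X) 0) (prod.lift 0 (𝟙 X))
  have : IsRegularEpi r := isRegularEpi_coprod_to_prod X X
  have hr := (isKernelOf_kernel r).isCokernelOf
  obtain ⟨Q, q, hq⟩ := exists_isCokernelOf (kernel.ι r ≫ coprod.desc (𝟙 X) (𝟙 X))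
  obtain ⟨wq, -, hq'⟩ := isCokernelOf_iff.1 hq
  obtain ⟨φ, hφ⟩ := (isCokernelOf_iff.1 hr).2.2 (coprod.desc (𝟙 X) (𝟙 X) ≫ q)
    (by simpa using wq)
  have hc := isKernelOf_kernel q
  refine ⟨_, kernel.ι q, hc.isNormalMono, (huqCommuteMod_iff hc).2 ⟨φ, ?_, ?_⟩, ?_⟩
  · simpa [r] using coprod.inl ≫= hφ
  · simpa [r] using coprod.inr ≫= hφ
  · intro N n hn hcn
    obtain ⟨Y, h, hn⟩ := isNormalMono_iff.1 hn
    obtain ⟨ψ, h₁, h₂⟩ := (huqCommuteMod_iff hn).1 hcn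
    have hψ : r ≫ ψ = coprod.desc (𝟙 X) (𝟙 X) ≫ h := by
      ext
      · simpa [r] using h₁
      · simpa [r] using h₂
    obtain ⟨l, rfl⟩ := hq' h (by rw [Category.assoc, ← hψ, kernel.condition_assoc, zero_comp])
    exact (isKernelOf_iff.1 hn).2.2 _ (by rw [kernel.condition_assoc, zero_comp])

theorem IsCentral.huqCommute_id {Z X : C} {z : Z ⟶ X} [Mono z] (h : IsCentral z) :
    HuqCommute (𝟙 Z) (𝟙 Z) :=
  HuqCommute.of_comp_mono (m := z) (by simpa using HuqCommute.precomp h (𝟙 Z) z)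

/-- If `Z` is commutative, then `[Z ⨯ X, Z ⨯ X]` is `0 × [X, X]`. -/
theorem IsHuqCommutator.prod {Z X D : C} (hZ : HuqCommute (𝟙 Z) (𝟙 Z)) {c : D ⟶ X}
    (hc : IsHuqCommutator (𝟙 X) (𝟙 X) c) :
    IsHuqCommutator (𝟙 (Z ⨯ X)) (𝟙 (Z ⨯ X)) (c ≫ prod.lift 0 (𝟙 X)) := by
  obtain ⟨Q, q, hq, ψ, hψ₁, hψ₂⟩ := hc.commute
  obtain ⟨ζ, hζ₁, hζ₂⟩ := hZ
  obtain ⟨w, hm, hl⟩ := isKernelOf_iff.1 (IsKernelOf.of_isCokernelOf hc.normal hq)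
  have hk : IsKernelOf (c ≫ prod.lift (0 : X ⟶ Z) (𝟙 X)) (prod.map (𝟙 Z) q) := by
    refine isKernelOf_iff.2 ⟨?_, ?_, fun T t ht => ?_⟩
    · ext <;> simp [w]
    · have : Mono ((c ≫ prod.lift (0 : X ⟶ Z) (𝟙 X)) ≫ (prod.snd : Z ⨯ X ⟶ X)) := by
        simpa
      exact mono_of_mono _ prod.snd
    · obtain ⟨l, hl⟩ := hl (t ≫ prod.snd) (by simpa using ht =≫ (prod.snd : Z ⨯ Q ⟶ Q))
      refine ⟨l, ?_⟩
      ext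
      · simpa using (ht =≫ (prod.fst : Z ⨯ Q ⟶ Z)).symm
      · simpa using hl
  let π₁ : Z ⨯ X ⟶ Z := prod.fst
  let π₂ : Z ⨯ X ⟶ X := prod.snd
  refine ⟨hk.isNormalMono, (huqCommuteMod_iff hk).2
    ⟨prod.lift (prod.map π₁ π₁ ≫ ζ) (prod.map π₂ π₂ ≫ ψ), ?_, ?_⟩, ?_⟩
  · have e₁ : prod.lift (𝟙 (Z ⨯ X)) 0 ≫ prod.map π₁ π₁ =
        π₁ ≫ prod.lift (𝟙 Z) (0 : Z ⟶ Z) := by ext <;> simp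
    have e₂ : prod.lift (𝟙 (Z ⨯ X)) 0 ≫ prod.map π₂ π₂ =
        π₂ ≫ prod.lift (𝟙 X) (0 : X ⟶ X) := by ext <;> simp
    ext
    · simp only [Category.assoc, prod.lift_fst, reassoc_of% e₁, hζ₁]; simp [π₁]
    · simp only [Category.assoc, prod.lift_snd, reassoc_of% e₂, hψ₁]; simp [π₂]
  · have e₁ : prod.lift 0 (𝟙 (Z ⨯ X)) ≫ prod.map π₁ π₁ =
        π₁ ≫ prod.lift (0 : Z ⟶ Z) (𝟙 Z) := by ext <;> simp
    have e₂ : prod.lift 0 (𝟙 (Z ⨯ X)) ≫ prod.map π₂ π₂ =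
        π₂ ≫ prod.lift (0 : X ⟶ X) (𝟙 X) := by ext <;> simp
    ext
    · simp only [Category.assoc, prod.lift_fst, reassoc_of% e₁, hζ₂]; simp [π₁]
    · simp only [Category.assoc, prod.lift_snd, reassoc_of% e₂, hψ₂]; simp [π₂]
  · intro N n hn hcn
    obtain ⟨Y, h, hn⟩ := isNormalMono_iff.1 hn
    have h' := ((huqCommuteMod_iff hn).1 hcn).precomp (prod.lift 0 (𝟙 X)) (prod.lift 0 (𝟙 X))
    have hk' := isKernelOf_kernel (prod.lift (0 : X ⟶ Z) (𝟙 X) ≫ h)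
    obtain ⟨t, ht⟩ := hc.initial _ hk'.isNormalMono
      ((huqCommuteMod_iff hk').2 (by simpa using h'))
    refine (isKernelOf_iff.1 hn).2.2 _ ?_
    rw [← ht, Category.assoc, Category.assoc, kernel.condition, comp_zero]

/-- If the kernel `z` of `g` is central with cooperator `φ`, thought of as `(a, x) ↦ z a + x`, then
`φ` and the second projection form a kernel pair of `g`. -/
theorem IsKernelOf.isKernelPair_of_central {Z X Y : C} {z : Z ⟶ X} {g : X ⟶ Y}
    (hz : IsKernelOf z g) {φ : Z ⨯ X ⟶ X} (h₁ : prod.lift (𝟙 Z) 0 ≫ φ = z)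
    (h₂ : prod.lift 0 (𝟙 X) ≫ φ = 𝟙 X) : IsKernelPair g φ prod.snd := by
  have w : φ ≫ g = prod.snd ≫ g := by
    refine prod_hom_ext_of_inclusions ?_ ?_
    · rw [reassoc_of% h₁, (isKernelOf_iff.1 hz).1, prod.lift_snd_assoc, zero_comp]
    · rw [reassoc_of% h₂, prod.lift_snd_assoc, Category.id_comp]
  have hp := IsKernelPair.of_hasPullback g
  have : IsIso (pullback.lift φ prod.snd w) := by
    refine IsSemiAbelian.splitShortFive _ _ _ _ _ _ (𝟙 Z) _ (𝟙 X) (isSplitExtension_prod Z X)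
      (isSplitExtension_kernelPair hz hp) (hp.hom_ext ?_ ?_) (hp.hom_ext ?_ ?_) ?_
      inferInstance inferInstance
    · simp [h₁, hp.lift_fst]
    · simp [hp.lift_snd]
    · simp [h₂, hp.lift_fst]
    · simp [hp.lift_snd]
    · simp
  exact IsPullback.of_iso_pullback ⟨w⟩ (asIso (pullback.lift φ prod.snd w)) (by simp) (by simp)

end Commutators

/-! ### Internal actions and split extensions -/

section Actions

variable {C : Type u} [Category.{v} C] [HasZeroMorphisms C] [IsSemiAbelian C]

theorem isInternalAction_iff {B X : C} (χ : flatObj B X ⟶ X) :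
    IsInternalAction χ ↔ flatUnit B X ≫ χ = 𝟙 X ∧ flatMul B X ≫ χ = flatMap B χ ≫ χ :=
  Iff.rfl

theorem restrictsTo_iff {B X S : C} (χ : flatObj B X ⟶ X) (m : S ⟶ X) (ξ : flatObj B S ⟶ S) :
    RestrictsTo χ m ξ ↔ flatMap B m ≫ χ = ξ ≫ m :=
  Iff.rfl

theorem flatMap_comp (B : C) {X Y Z : C} (f : X ⟶ Y) (g : Y ⟶ Z) :
    flatMap B (f ≫ g) = flatMap B f ≫ flatMap B g :=
  (flatMonad B).map_comp f g

theorem flatUnit_naturality (B : C) {X Y : C} (f : X ⟶ Y) :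
    flatUnit B X ≫ flatMap B f = f ≫ flatUnit B Y :=
  ((flatMonad B).η.naturality f).symm

theorem flatMul_naturality (B : C) {X Y : C} (f : X ⟶ Y) :
    flatMul B X ≫ flatMap B f = flatMap B (flatMap B f) ≫ flatMul B Y :=
  ((flatMonad B).μ.naturality f).symm

/-- A morphism `B ♭ S ⟶ S` is an action if it is compatible with actions along a jointly monic
family out of `S`. -/
theorem isInternalAction_of_jointly_mono {B S : C} {I : Type*} {X : I → C} (m : ∀ i, S ⟶ X i)
    (hm : ∀ ⦃T : C⦄ (a b : T ⟶ S), (∀ i, a ≫ m i = b ≫ m i) → a = b)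
    (χ : ∀ i, flatObj B (X i) ⟶ X i) (hχ : ∀ i, IsInternalAction (χ i)) (ξ : flatObj B S ⟶ S)
    (hξ : ∀ i, flatMap B (m i) ≫ χ i = ξ ≫ m i) : IsInternalAction ξ := by
  refine (isInternalAction_iff ξ).2 ⟨hm _ _ fun i => ?_, hm _ _ fun i => ?_⟩ <;>
    obtain ⟨h₁, h₂⟩ := (isInternalAction_iff _).1 (hχ i)
  · rw [Category.assoc, ← hξ, ← Category.assoc, flatUnit_naturality, Category.assoc, h₁,
      Category.id_comp, Category.comp_id]
  · rw [Category.assoc, Category.assoc, ← hξ, ← Category.assoc, flatMul_naturality,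
      Category.assoc, h₂, ← Category.assoc, ← flatMap_comp, hξ, flatMap_comp, Category.assoc, hξ]

/-- Every internal action is the conjugation action of a split extension, its semidirect product.
This is the part of the monadicity of the kernel functor which concerns objects. The middle object
is the coequalizer of the pair `[ι₁, k], 1 + χ : B + (B ♭ X) ⇉ B + X`; on kernels over `B` this pair
is `flatMul B X, flatMap B χ`, whose coequalizer is `χ`. -/
theorem IsInternalAction.exists_isSplitExtension {B X : C} {χ : flatObj B X ⟶ X}
    (hχ : IsInternalAction χ) :
    ∃ (A : C) (κ : X ⟶ A) (α : A ⟶ B) (β : B ⟶ A),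
      IsSplitExtension κ α β ∧ χ ≫ κ = flatι B X ≫ coprod.desc β κ := by
  obtain ⟨hη, hμ⟩ := (isInternalAction_iff χ).1 hχ
  let d₀ : B ⨿ flatObj B X ⟶ B ⨿ X := coprod.desc coprod.inl (flatι B X)
  let d₁ : B ⨿ flatObj B X ⟶ B ⨿ X := coprod.map (𝟙 B) χ
  let p : B ⨿ X ⟶ B := coprod.desc (𝟙 B) 0
  obtain ⟨R, A, e, p₁, p₂, q, he, hq, h₁, h₂, hp⟩ := exists_quotient_of_reflexive_pair d₀ d₁
    (coprod.map (𝟙 B) (flatUnit B X)) (by simp [d₀]) (by simp [d₁, hη])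
  have hd : d₀ ≫ q = d₁ ≫ q := by rw [← h₁, ← h₂, Category.assoc, Category.assoc, hp.w]
  have hd₀p : d₀ ≫ p = coprod.desc (𝟙 B) 0 := by
    ext
    · simp [d₀, p]
    · simp [d₀, p, flatι_desc]
  have hd₁p : d₁ ≫ p = coprod.desc (𝟙 B) 0 := by ext <;> simp [d₁, p]
  have hpp : p₁ ≫ p = p₂ ≫ p := by
    rw [← cancel_epi e, reassoc_of% h₁, reassoc_of% h₂, hd₀p, hd₁p]
  obtain ⟨α, hα⟩ := exists_desc_of_isRegularEpi q p fun W a b hab => by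
    rw [← hp.lift_fst a b hab, Category.assoc, hpp, ← Category.assoc, hp.lift_snd]
  have hχq : χ ≫ coprod.inr ≫ q = flatι B X ≫ q := by
    simpa [d₀, d₁] using (coprod.inr ≫= hd).symm
  have hrq : coprod.inr ≫ q ≫ α = 0 := by rw [hα]; simp [p]
  -- The comparison of `X` with the kernel of `α` is shown to be invertible.
  let q' : flatObj B X ⟶ kernel α := kernel.lift α (flatι B X ≫ q)
    (by rw [Category.assoc, hα, flatι_desc])
  have hq'ι : q' ≫ kernel.ι α = flatι B X ≫ q := kernel.lift_ι _ _ _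
  have hpb : IsPullback q' (flatι B X) (kernel.ι α) q := by
    refine ⟨⟨hq'ι⟩, ⟨PullbackCone.IsLimit.mk _
      (fun s => flatLift s.snd (by
        change s.snd ≫ p = 0
        rw [← hα, ← Category.assoc, ← s.condition, Category.assoc, kernel.condition, comp_zero]))
      (fun s => ?_) (fun s => flatLift_ι _ _) (fun s m _ hm => ?_)⟩⟩
    · rw [← cancel_mono (kernel.ι α), Category.assoc, hq'ι, ← Category.assoc, flatLift_ι,
        s.condition]
    · rw [← cancel_mono (flatι B X), hm, flatLift_ι]
  have : IsRegularEpi q' :=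
    Regular.regularEpiIsStableUnderBaseChange.of_isPullback hpb.flip hq
  -- Elements of `B ♭ X` identified by `q` lift, locally, to an element of `B + (B ♭ X)`, which is
  -- killed by `[1, 0]` and therefore lies in `B ♭ (B ♭ X)`, where associativity of `χ` applies.
  obtain ⟨v, hv⟩ := exists_desc_of_isRegularEpi q' χ fun W a b hab => by
    have hab' : (a ≫ flatι B X) ≫ q = (b ≫ flatι B X) ≫ q := by
      simpa [hq'ι] using hab =≫ kernel.ι α
    let l := hp.lift _ _ hab'
    let w := pullback.snd l e
    have hw₁ : w ≫ d₀ = pullback.fst l e ≫ a ≫ flatι B X := by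
      rw [← h₁, ← Category.assoc, ← pullback.condition, Category.assoc, hp.lift_fst]
    have hw₂ : w ≫ d₁ = pullback.fst l e ≫ b ≫ flatι B X := by
      rw [← h₂, ← Category.assoc, ← pullback.condition, Category.assoc, hp.lift_snd]
    have hw : w ≫ coprod.desc (𝟙 B) 0 = 0 := by
      rw [← hd₀p, ← Category.assoc, hw₁, Category.assoc, Category.assoc, flatι_desc, comp_zero,
        comp_zero]
    have ha : flatLift w hw ≫ flatMul B X = pullback.fst l e ≫ a := by
      rw [← cancel_mono (flatι B X), Category.assoc, flatMul_ι, ← Category.assoc, flatLift_ι,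
        Category.assoc]
      exact hw₁
    have hb : flatLift w hw ≫ flatMap B χ = pullback.fst l e ≫ b := by
      rw [← cancel_mono (flatι B X), Category.assoc, flatMap_ι, ← Category.assoc, flatLift_ι,
        Category.assoc]
      exact hw₂
    rw [← cancel_epi (pullback.fst l e), ← Category.assoc, ← ha, Category.assoc, hμ,
      ← Category.assoc, hb, Category.assoc]
  let u : X ⟶ kernel α := kernel.lift α (coprod.inr ≫ q) (by simpa using hrq)
  have hu : u ≫ kernel.ι α = coprod.inr ≫ q := kernel.lift_ι _ _ _
  have hχu : χ ≫ u = q' := by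
    rw [← cancel_mono (kernel.ι α), Category.assoc, hu, hq'ι, hχq]
  have huv : u ≫ v = 𝟙 X := by
    rw [← Category.id_comp u, ← hη, Category.assoc, Category.assoc, reassoc_of% hχu, hv]
  have hvu : v ≫ u = 𝟙 _ := by
    rw [← cancel_epi q', reassoc_of% hv, hχu, Category.comp_id]
  refine ⟨A, coprod.inr ≫ q, α, coprod.inl ≫ q, ⟨?_, isKernelOf_iff.2 ⟨?_, ?_, fun T t ht =>
    ⟨kernel.lift α t ht ≫ v, ?_⟩⟩⟩, ?_⟩
  · rw [Category.assoc, hα, coprod.inl_desc]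
  · rw [Category.assoc, hrq]
  · have : IsSplitMono u := ⟨⟨v, huv⟩⟩
    rw [← hu]
    exact mono_comp _ _
  · rw [← hu, Category.assoc, reassoc_of% hvu, kernel.lift_ι]
  · rw [hχq]
    congr 1
    ext <;> simp

/-- In an extension which induces `χ`, the morphism `flatMap B m ≫ χ` depends, after composition
with `κ ≫ s`, only on `m ≫ κ ≫ s`. -/
theorem flatMap_comp_eq_of_extension {B X S A : C} {κ : X ⟶ A} {β : B ⟶ A} {χ : flatObj B X ⟶ X}
    (hχ : χ ≫ κ = flatι B X ≫ coprod.desc β κ) (m : S ⟶ X) {Y : C} (s : A ⟶ Y) :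
    flatMap B m ≫ χ ≫ κ ≫ s = flatι B S ≫ coprod.desc (β ≫ s) (m ≫ κ ≫ s) := by
  rw [reassoc_of% hχ, flatMap_ι_assoc]
  congr 1
  ext <;> simp

/-- An action restricts to every subobject which is normal in an extension inducing the action. -/
theorem exists_restriction_of_normal {B X D A : C} {κ : X ⟶ A} {β : B ⟶ A}
    {χ : flatObj B X ⟶ X} (hχ : IsInternalAction χ) [Mono κ]
    (hκ : χ ≫ κ = flatι B X ≫ coprod.desc β κ) (d : D ⟶ X) (hd : IsNormalMono (d ≫ κ)) :
    ∃ ξ : flatObj B D ⟶ D, IsInternalAction ξ ∧ RestrictsTo χ d ξ := by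
  obtain ⟨Y, s, hs⟩ := isNormalMono_iff.1 hd
  obtain ⟨w, hm, hl⟩ := isKernelOf_iff.1 hs
  have : Mono d := mono_of_mono d κ
  obtain ⟨ξ, hξ⟩ := hl (flatMap B d ≫ χ ≫ κ) (by
    have w' : d ≫ κ ≫ s = 0 := by simpa using w
    have h : coprod.desc (β ≫ s) (0 : D ⟶ Y) = coprod.desc (𝟙 B) 0 ≫ β ≫ s := by ext <;> simp
    rw [Category.assoc, Category.assoc, flatMap_comp_eq_of_extension hκ, w', h, ← Category.assoc,
      flatι_desc, zero_comp])
  have hξ' : flatMap B d ≫ χ = ξ ≫ d := by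
    rw [← cancel_mono κ, Category.assoc, Category.assoc, hξ]
  exact ⟨ξ, isInternalAction_of_jointly_mono (I := Unit) (fun _ => d)
    (fun _ a b h => (cancel_mono d).1 (h ())) (fun _ => χ) (fun _ => hχ) ξ (fun _ => hξ'), hξ'⟩

theorem flatMap_comp_eq_of_kernelPair {B X A S Y : C} {κ : X ⟶ A} {β : B ⟶ A}
    {χ : flatObj B X ⟶ X} (hκ : χ ≫ κ = flatι B X ≫ coprod.desc β κ) (s : A ⟶ Y) {a b : S ⟶ X}
    (h : a ≫ κ ≫ s = b ≫ κ ≫ s) : flatMap B a ≫ χ ≫ κ ≫ s = flatMap B b ≫ χ ≫ κ ≫ s := by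
  rw [flatMap_comp_eq_of_extension hκ, flatMap_comp_eq_of_extension hκ, h]

end Actions

end SemiAb

open SemiAb in
theorem proposition2p5 {C : Type u} [Category.{v} C] [HasZeroMorphisms C]
    [SemiAb.IsSemiAbelian C] (hWNH : SemiAb.WNH C)
    (hcenter : ∀ X : C, ∃ (Z : C) (z : Z ⟶ X), SemiAb.IsCenter z ∧ SemiAb.IsCharacteristic z)
    {B X Z : C} (f : X ⟶ Z) (hf : SemiAb.IsCentral (kernel.ι f))
    (χ₁ χ₂ : (SemiAb.flatMonad B).obj X ⟶ X)
    (hχ₁ : SemiAb.IsInternalAction χ₁) (hχ₂ : SemiAb.IsInternalAction χ₂)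
    (hχ : χ₁ ≫ f = χ₂ ≫ f) :
    (∃ (D : C) (c : D ⟶ X), SemiAb.IsHuqCommutator (𝟙 X) (𝟙 X) c) ∧
    ∀ (D : C) (c : D ⟶ X), SemiAb.IsHuqCommutator (𝟙 X) (𝟙 X) c →
      ∃ ξ : (SemiAb.flatMonad B).obj D ⟶ D, SemiAb.IsInternalAction ξ ∧
        SemiAb.RestrictsTo χ₁ c ξ ∧ SemiAb.RestrictsTo χ₂ c ξ := by
  refine ⟨exists_isHuqCommutator_id X, fun D c hc => ?_⟩
  change flatObj B X ⟶ X at χ₁ χ₂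
  obtain ⟨Z', z, hz, hzc⟩ := hcenter X
  obtain ⟨A, κ, α, β, hA, hκ⟩ := hχ₁.exists_isSplitExtension
  obtain ⟨Y, s, hs⟩ := isNormalMono_iff.1 (hzc.2 κ hA.isKernel.isNormalMono)
  obtain ⟨ws, hms, hls⟩ := isKernelOf_iff.1 hs
  have : Mono κ := (isKernelOf_iff.1 hA.isKernel).2.1
  have : Mono z := mono_of_mono z κ
  -- The action `χ₁` descends along `g = κ ≫ s`, whose kernel is the center.
  have hzg : IsKernelOf z (κ ≫ s) := by
    refine isKernelOf_iff.2 ⟨by simpa using ws, inferInstance, fun T t ht => ?_⟩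
    obtain ⟨l, hl⟩ := hls (t ≫ κ) (by simpa using ht)
    exact ⟨l, by rw [← cancel_mono κ, Category.assoc, hl]⟩
  have hg : χ₁ ≫ κ ≫ s = χ₂ ≫ κ ≫ s := by
    obtain ⟨t, ht, -⟩ := hz.terminal (kernel.ι f) hf
    refine comp_eq_of_kernel_comp_eq_zero (isKernelOf_kernel f) ?_ hχ
    rw [← ht, Category.assoc, (isKernelOf_iff.1 hzg).1, comp_zero]
  obtain ⟨φ, hφ₁, hφ₂⟩ := hz.commute
  have hp := hzg.isKernelPair_of_central hφ₁ hφ₂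
  have hρ : (flatMap B φ ≫ χ₁) ≫ κ ≫ s = (flatMap B prod.snd ≫ χ₂) ≫ κ ≫ s := by
    rw [Category.assoc, Category.assoc, ← hg, flatMap_comp_eq_of_kernelPair hκ s hp.w]
  -- The action on the kernel pair of `g` which covers `χ₁` and `χ₂`.
  let ρ : flatObj B (Z' ⨯ X) ⟶ Z' ⨯ X := hp.lift _ _ hρ
  have hρ₁ : ρ ≫ φ = flatMap B φ ≫ χ₁ := hp.lift_fst _ _ _
  have hρ₂ : ρ ≫ prod.snd = flatMap B prod.snd ≫ χ₂ := hp.lift_snd _ _ _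
  have hρa : IsInternalAction ρ :=
    isInternalAction_of_jointly_mono (I := Bool) (X := fun _ => X)
      (fun i => bif i then φ else prod.snd)
      (fun _ a b h => hp.hom_ext (h true) (h false)) (fun i => bif i then χ₁ else χ₂)
      (by rintro (_ | _); exacts [hχ₂, hχ₁]) ρ (by rintro (_ | _); exacts [hρ₂.symm, hρ₁.symm])
  obtain ⟨P, κ', α', β', hP, hκ'⟩ := hρa.exists_isSplitExtension
  have : Mono κ' := (isKernelOf_iff.1 hP.isKernel).2.1
  have hn := (hWNH κ' hP.isKernel.isNormalMono _
    (hc.prod (IsCentral.huqCommute_id hz.commute))).normal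
  obtain ⟨ξ, hξ, hr⟩ := exists_restriction_of_normal hρa hκ' _ hn
  rw [restrictsTo_iff] at hr
  refine ⟨ξ, hξ, (restrictsTo_iff _ _ _).2 ?_, (restrictsTo_iff _ _ _).2 ?_⟩
  · have h := hr =≫ φ
    rw [Category.assoc, hρ₁, ← Category.assoc, ← flatMap_comp, Category.assoc, Category.assoc,
      Category.assoc, hφ₂, Category.comp_id] at h
    exact h
  · have h := hr =≫ prod.snd
    rw [Category.assoc, hρ₂, ← Category.assoc, ← flatMap_comp, Category.assoc, Category.assoc,
      Category.assoc, prod.lift_snd, Category.comp_id] at h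
    exact h
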